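/- Let $d\ge 1$ be an integer. A Lévy measure on $\mathbb{R}^d$ is a positive Borel measure $\nu$ with $\nu(\{0\})=0$ and $\int_{\mathbb{R}^d}(1\wedge\|u\|^2)\,\nu(du)<+\infty$. A random vector $X$ in $\mathbb{R}^d$ is infinitely divisible with Lévy measure $\nu$ if $\nu$ is a Lévy measure and there are $b\in\mathbb{R}^d$ and a symmetric nonnegative definite $d\times d$ matrix $A$ such that, for all $\xi\in\mathbb{R}^d$, $$\mathbb{E}\,e^{i\langle \xi;X\rangle}=\exp\left(i\langle b;\xi\rangle-\frac12\langle\xi;A\xi\rangle+\int_{\mathbb{R}^d}\left(e^{i\langle\xi;u\rangle}-1-i\langle\xi;u\rangle\mathbf{1}_{\{\|u\|\le 1\}}\right)\nu(du)\right).$$ A random vector in $\mathbb{R}^d$ is non-degenerate if the support of its law is not contained in a $(d-1)$-dimensional linear subspace of $\mathbb{R}^d$. Let $\mathcal{P}(\nu)$ be the set of probability measures $\mu$ on $\mathbb{R}^d$ such that $\nu\ast\mu\ll\mu$, where $\nu\ast\mu$ is the convolution of the two positive measures $\nu$ and $\mu$. Let $X$ be a non-degenerate infinitely divisible random vector in $\mathbb{R}^d$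 with law $\mu_X$ and Lévy measure $\nu$, and let $Y$ be a non-degenerate random vector in $\mathbb{R}^d$ with law $\mu_Y$ such that $\mu_Y\sim\mu_X$, that is, for every Borel set $B\subseteq\mathbb{R}^d$, $\mu_Y(B)=0$ if and only if $\mu_X(B)=0$. Then $\mu_Y\in\mathcal{P}(\nu)$. -/

import Mathlib

open MeasureTheory
open scoped Matrix

/-- A Lévy measure on `ℝᵈ`: a positive Borel measure with no atom at the origin which integrates
`1 ∧ ‖u‖²`. -/
structure IsLevyMeasure {d : ℕ} (ν : Measure (EuclideanSpace ℝ (Fin d))) : Prop where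
  zero_singleton : ν {0} = 0
  lintegral_lt_top : ∫⁻ u, ENNReal.ofReal (min 1 (‖u‖ ^ 2)) ∂ν < ⊤

/-- The Lévy–Khintchine exponent of the triplet `(b, A, ν)`, with truncation on the closed
Euclidean unit ball. -/
noncomputable def levyKhintchineExponent {d : ℕ} (b : EuclideanSpace ℝ (Fin d))
    (A : Matrix (Fin d) (Fin d) ℝ) (ν : Measure (EuclideanSpace ℝ (Fin d)))
    (ξ : EuclideanSpace ℝ (Fin d)) : ℂ :=
  Complex.I * (inner ℝ b ξ : ℝ) - (1 / 2 : ℂ) * (inner ℝ ξ (A.toEuclideanLin ξ) : ℝ)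
    + ∫ u, (Complex.exp (Complex.I * (inner ℝ ξ u : ℝ)) - 1
        - Complex.I *
          ((Metric.closedBall (0 : EuclideanSpace ℝ (Fin d)) 1).indicator
            (fun v => inner ℝ ξ v) u : ℝ)) ∂ν

/-- `μ` is the infinitely divisible law `ID(b, A, ν)` on `ℝᵈ`: `A` is symmetric nonnegative
definite, `ν` is a Lévy measure, and the characteristic function of `μ` has the Lévy–Khintchine
form with triplet `(b, A, ν)`. -/
structure IsInfinitelyDivisibleWithTriplet {d : ℕ} (μ : Measure (EuclideanSpace ℝ (Fin d)))
    (b : EuclideanSpace ℝ (Fin d)) (A : Matrix (Fin d) (Fin d) ℝ)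
    (ν : Measure (EuclideanSpace ℝ (Fin d))) : Prop where
  isProbabilityMeasure : IsProbabilityMeasure μ
  posSemidef : A.PosSemidef
  isLevyMeasure : IsLevyMeasure ν
  charFun_eq : ∀ ξ, charFun μ ξ = Complex.exp (levyKhintchineExponent b A ν ξ)

/-- `μ` is infinitely divisible with Lévy measure `ν`. -/
def IsInfinitelyDivisibleWithLevyMeasure {d : ℕ} (μ ν : Measure (EuclideanSpace ℝ (Fin d))) :
    Prop :=
  ∃ b A, IsInfinitelyDivisibleWithTriplet μ b A ν

/-- A law on `ℝᵈ` is non-degenerate if its support is not contained in a linear subspace of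
dimension `d - 1`. -/
def IsNonDegenerate {d : ℕ} (μ : Measure (EuclideanSpace ℝ (Fin d))) : Prop :=
  ¬ ∃ V : Submodule ℝ (EuclideanSpace ℝ (Fin d)),
    Module.finrank ℝ V + 1 = d ∧ μ.support ⊆ (V : Set (EuclideanSpace ℝ (Fin d)))

/-- The class `𝒫(ν)` of probability measures `μ` on `ℝᵈ` such that `ν ∗ μ ≪ μ`. -/
def levyAbsContClass {d : ℕ} (ν : Measure (EuclideanSpace ℝ (Fin d))) :
    Set (Measure (EuclideanSpace ℝ (Fin d))) :=
  {μ | IsProbabilityMeasure μ ∧ ν.conv μ ≪ μ}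

open Filter
open scoped Topology RealInnerProductSpace

/-! ### Convolution, absolute continuity and compound Poisson laws. -/

section Convolution

variable {M : Type*} [AddCommMonoid M] [MeasurableSpace M] [MeasurableAdd₂ M]

/-! Absolute continuity passes through convolution, so `ν ∗ μ_Y ≪ ν ∗ μ_X` and everything reduces to
`ν ∗ μ_X ≪ μ_X`. Let `η` be the restriction of `ν` to jumps longer than `1 / (n + 1)`; it is finite.
The law factors as `μ_X = compoundPoisson η ∗ δ ∗ σ` (`exists_eq_conv`), and convolving with `η`
only shifts the index in the series of convolution powers of `η`, so `η ∗ μ_X ≪ μ_X`. These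
restrictions exhaust `ν`, which does not charge the origin. The factor `σ` comes from Lévy's
continuity theorem: its characteristic function is a limit of those of a Gaussian convolved with
compensated compound Poisson laws of ever smaller jumps. -/

lemma conv_apply_eq_zero_iff (ν μ : Measure M) [SFinite μ] {s : Set M} (hs : MeasurableSet s) :
    (ν.conv μ) s = 0 ↔ ∀ᵐ x ∂ν, μ ((fun y ↦ x + y) ⁻¹' s) = 0 := by
  rw [Measure.conv, Measure.map_apply (by fun_prop) hs,
    Measure.measure_prod_null (hs.preimage (by fun_prop))]
  rfl

lemma conv_absolutelyContinuous_iff (ν μ ρ : Measure M) [SFinite μ] :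
    ν.conv μ ≪ ρ ↔ ∀ s, MeasurableSet s → ρ s = 0 →
      ∀ᵐ x ∂ν, μ ((fun y ↦ x + y) ⁻¹' s) = 0 := by
  refine ⟨fun h s hs h0 ↦ (conv_apply_eq_zero_iff ν μ hs).1 (h h0), fun h ↦ ?_⟩
  exact Measure.AbsolutelyContinuous.mk fun s hs h0 ↦ (conv_apply_eq_zero_iff ν μ hs).2 (h s hs h0)

/-- For a fixed null set the condition is a `ν`-a.e. statement about the jump, so it can be checked
on countably many pieces. -/
lemma conv_absolutelyContinuous_of_iUnion {ι : Type*} [Countable ι] (ν μ ρ : Measure M) [SFinite μ]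
    (S : ι → Set M) (hS : ν (⋃ i, S i)ᶜ = 0) (h : ∀ i, (ν.restrict (S i)).conv μ ≪ ρ) :
    ν.conv μ ≪ ρ := by
  rw [conv_absolutelyContinuous_iff]
  intro s hs h0
  have key := (ae_restrict_iUnion_iff (μ := ν) S fun x ↦ μ ((fun y ↦ x + y) ⁻¹' s) = 0).2
    fun i ↦ (conv_absolutelyContinuous_iff _ _ _).1 (h i) s hs h0
  rwa [Measure.restrict_eq_self_of_ae_mem] at key
  exact hS

lemma AbsolutelyContinuous.conv {μ μ' ν ν' : Measure M} [SFinite ν'] (h : μ ≪ μ') (h' : ν ≪ ν') :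
    μ.conv ν ≪ μ'.conv ν' :=
  (h.prod h').map (by fun_prop)

lemma conv_sum (μ : Measure M) {ι : Type*} [Countable ι] (m : ι → Measure M) [∀ i, SFinite (m i)] :
    μ.conv (Measure.sum m) = Measure.sum fun i ↦ μ.conv (m i) := by
  rw [Measure.conv, Measure.prod_sum_right, Measure.map_sum (by fun_prop)]
  rfl

/-- The `n`-th convolution power of a measure. -/
noncomputable def convPow (μ : Measure M) : ℕ → Measure M
  | 0 => Measure.dirac 0
  | n + 1 => μ.conv (convPow μ n)

instance isFiniteMeasure_convPow (μ : Measure M) [IsFiniteMeasure μ] (n : ℕ) :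
    IsFiniteMeasure (convPow μ n) := by
  induction n with
  | zero => rw [convPow]; infer_instance
  | succ n ih => rw [convPow]; infer_instance

lemma convPow_univ (μ : Measure M) [IsFiniteMeasure μ] (n : ℕ) :
    convPow μ n Set.univ = μ Set.univ ^ n := by
  induction n with
  | zero => simp [convPow]
  | succ n ih =>
    rw [convPow, Measure.conv, Measure.map_apply (by fun_prop) .univ, Set.preimage_univ,
      ← Set.univ_prod_univ, Measure.prod_prod, ih, pow_succ']

/-- The Poisson weight `e^{-r} / n!`, without the power `r ^ n`. -/
noncomputable def expWeight (r : ℝ) (n : ℕ) : ℝ := Real.exp (-r) * (n.factorial : ℝ)⁻¹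

lemma expWeight_pos (r : ℝ) (n : ℕ) : 0 < expWeight r n := by
  unfold expWeight; positivity

/-- The compound Poisson law with jump measure `μ`. -/
noncomputable def compoundPoisson (μ : Measure M) : Measure M :=
  Measure.sum fun n ↦ ENNReal.ofReal (expWeight (μ.real Set.univ) n) • convPow μ n

instance isProbabilityMeasure_compoundPoisson (μ : Measure M) [IsFiniteMeasure μ] :
    IsProbabilityMeasure (compoundPoisson μ) := by
  constructor
  rw [compoundPoisson, Measure.sum_apply _ .univ]
  have h (n : ℕ) : (ENNReal.ofReal (expWeight (μ.real Set.univ) n) • convPow μ n) Set.univ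
      = ENNReal.ofReal (Real.exp (-μ.real Set.univ) *
        ((n.factorial : ℝ)⁻¹ * μ.real Set.univ ^ n)) := by
    rw [Measure.smul_apply, convPow_univ, smul_eq_mul, ← ofReal_measureReal (μ := μ),
      ← ENNReal.ofReal_pow measureReal_nonneg, ← ENNReal.ofReal_mul (expWeight_pos _ _).le,
      expWeight, mul_assoc]
  have hs : HasSum (fun n : ℕ ↦ Real.exp (-μ.real Set.univ) *
      ((n.factorial : ℝ)⁻¹ * μ.real Set.univ ^ n)) 1 := by
    have := (NormedSpace.exp_series_hasSum_exp' (𝕂 := ℝ) (μ.real Set.univ)).mul_left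
      (Real.exp (-μ.real Set.univ))
    rw [← Real.exp_eq_exp_ℝ, ← Real.exp_add, neg_add_cancel, Real.exp_zero] at this
    simpa using this
  simp_rw [h]
  rw [← ENNReal.ofReal_tsum_of_nonneg (fun n ↦ by positivity) hs.summable, hs.tsum_eq,
    ENNReal.ofReal_one]

/-- Convolution with `μ` turns the `n`-th power into the `(n + 1)`-st, which the series also
contains with positive weight. The powers are not normalised, so this holds even for `μ = 0`. -/
lemma conv_compoundPoisson_absolutelyContinuous (μ : Measure M) [IsFiniteMeasure μ] :
    μ.conv (compoundPoisson μ) ≪ compoundPoisson μ := by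
  rw [compoundPoisson, conv_sum]
  refine Measure.AbsolutelyContinuous.mk fun s hs h0 ↦ ?_
  rw [Measure.sum_apply _ hs, ENNReal.tsum_eq_zero] at h0 ⊢
  intro n
  have h1 : convPow μ (n + 1) s = 0 := by
    simpa [(expWeight_pos _ _).not_ge] using h0 (n + 1)
  rw [convPow, conv_apply_eq_zero_iff _ _ hs] at h1
  rw [conv_apply_eq_zero_iff _ _ hs]
  filter_upwards [h1] with x hx
  simp [hx]

end Convolution

/-! ### Bounds on the Lévy–Khintchine integrand. -/

section LevyIntegrand

variable {E : Type*} [NormedAddCommGroup E] [InnerProductSpace ℝ E]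

/-- The integrand of the Lévy–Khintchine formula. -/
noncomputable def levyIntegrand (ξ u : E) : ℂ :=
  Complex.exp (Complex.I * (inner ℝ ξ u : ℝ)) - 1
    - Complex.I * ((Metric.closedBall (0 : E) 1).indicator (fun v => inner ℝ ξ v) u : ℝ)

lemma norm_exp_I_mul_ofReal_sub_one_sub_le (a : ℝ) :
    ‖Complex.exp (Complex.I * a) - 1 - Complex.I * a‖ ≤ 3 * a ^ 2 := by
  have hn : ‖Complex.I * (a : ℂ)‖ = |a| := by simp
  rcases le_total |a| 1 with h | h
  · refine (Complex.norm_exp_sub_one_sub_id_le (hn.trans_le h)).trans ?_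
    rw [hn, sq_abs]
    nlinarith [sq_nonneg a]
  · have h1 : ‖Complex.exp (Complex.I * a) - 1‖ ≤ |a| := Real.norm_exp_I_mul_ofReal_sub_one_le
    have h2 := norm_sub_le (Complex.exp (Complex.I * a) - 1) (Complex.I * a)
    rw [hn] at h2
    nlinarith [sq_abs a]

/-- This gives integrability against any Lévy measure. The term `3 * ‖ξ‖ ^ 2` serves the compensated
jumps in the unit ball, the `2` serves the others. -/
lemma norm_levyIntegrand_le (ξ u : E) :
    ‖levyIntegrand ξ u‖ ≤ (2 + 3 * ‖ξ‖ ^ 2) * min 1 (‖u‖ ^ 2) := by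
  unfold levyIntegrand
  by_cases hu : u ∈ Metric.closedBall (0 : E) 1
  · rw [Set.indicator_of_mem hu]
    have hu' : ‖u‖ ≤ 1 := by simpa using hu
    rw [min_eq_right (by nlinarith [norm_nonneg u])]
    refine (norm_exp_I_mul_ofReal_sub_one_sub_le _).trans ?_
    have h := abs_real_inner_le_norm ξ u
    have h2 : (inner ℝ ξ u : ℝ) ^ 2 ≤ (‖ξ‖ * ‖u‖) ^ 2 := by
      rw [← sq_abs]; gcongr
    nlinarith [sq_nonneg ‖u‖]
  · rw [Set.indicator_of_notMem hu]
    have hu' : 1 < ‖u‖ := by simpa using hu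
    rw [min_eq_left (by nlinarith)]
    have h := norm_sub_le (Complex.exp (Complex.I * (inner ℝ ξ u : ℝ))) 1
    rw [mul_comm, Complex.norm_exp_ofReal_mul_I] at h
    simp only [Complex.ofReal_zero, mul_zero, sub_zero, mul_one]
    rw [mul_comm]
    norm_num at h
    nlinarith [sq_nonneg ‖ξ‖]

end LevyIntegrand

section ExpInner

variable {E : Type*} [NormedAddCommGroup E] [InnerProductSpace ℝ E] [MeasurableSpace E]
  [BorelSpace E]

lemma integrable_exp_inner (μ : Measure E) [IsFiniteMeasure μ] (ξ : E) :
    Integrable (fun x ↦ Complex.exp (⟪x, ξ⟫ * Complex.I)) μ :=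
  (BoundedContinuousFunction.innerProbChar ξ).integrable μ

end ExpInner

/-! ### Characteristic functions and Lévy's continuity theorem. -/

section CharFun

variable {E : Type*} [NormedAddCommGroup E] [InnerProductSpace ℝ E] [FiniteDimensional ℝ E]
  [MeasurableSpace E] [BorelSpace E]

lemma charFun_convPow (μ : Measure E) [IsFiniteMeasure μ] (n : ℕ) (ξ : E) :
    charFun (convPow μ n) ξ = charFun μ ξ ^ n := by
  induction n with
  | zero => simp [convPow]
  | succ n ih => rw [convPow, charFun_conv, ih, pow_succ']

lemma charFun_compoundPoisson (μ : Measure E) [IsFiniteMeasure μ] (ξ : E) :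
    charFun (compoundPoisson μ) ξ = Complex.exp (charFun μ ξ - μ.real Set.univ) := by
  have hint : Integrable (fun x ↦ Complex.exp (⟪x, ξ⟫ * Complex.I)) (compoundPoisson μ) :=
    integrable_exp_inner _ ξ
  have h1 : HasSum (fun n ↦ (expWeight (μ.real Set.univ) n : ℂ) * charFun μ ξ ^ n)
      (charFun (compoundPoisson μ) ξ) := by
    have := hasSum_integral_measure hint
    rw [charFun_apply (μ := compoundPoisson μ)]
    refine this.congr_fun fun n ↦ ?_
    rw [integral_smul_measure, ENNReal.toReal_ofReal (expWeight_pos _ _).le, ← charFun_apply,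
      charFun_convPow, Complex.real_smul]
  have h2 : HasSum (fun n ↦ (expWeight (μ.real Set.univ) n : ℂ) * charFun μ ξ ^ n)
      (Complex.exp (charFun μ ξ - μ.real Set.univ)) := by
    have := (NormedSpace.exp_series_hasSum_exp' (𝕂 := ℂ) (charFun μ ξ)).mul_left
      (Complex.exp (-μ.real Set.univ))
    rw [← Complex.exp_eq_exp_ℂ, ← Complex.exp_add, neg_add_eq_sub] at this
    refine this.congr_fun fun n ↦ ?_
    simp [expWeight, mul_assoc]
  exact h1.unique h2

/-- **Lévy's continuity theorem**: a pointwise limit of characteristic functions which is continuous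
at the origin is a characteristic function. -/
theorem exists_charFun_eq_of_tendsto {μ : ℕ → Measure E} [hμ : ∀ n, IsProbabilityMeasure (μ n)]
    {f : E → ℂ} (hf : ContinuousAt f 0)
    (h : ∀ t, Tendsto (fun n ↦ charFun (μ n) t) atTop (𝓝 (f t))) :
    ∃ σ : Measure E, IsProbabilityMeasure σ ∧ ∀ t, charFun σ t = f t := by
  let p : ℕ → ProbabilityMeasure E := fun n ↦ ⟨μ n, hμ n⟩
  -- Continuity of the limit at the origin gives tightness; Prokhorov then yields a weakly
  -- convergent subsequence.
  have ht : IsTightMeasureSet {((q : ProbabilityMeasure E) : Measure E) | q ∈ Set.range p} := by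
    refine (isTightMeasureSet_of_tendsto_charFun hf h).subset ?_
    rintro _ ⟨_, ⟨n, rfl⟩, rfl⟩
    exact ⟨n, rfl⟩
  obtain ⟨σ, -, φ, hφ, hlim⟩ := (isCompact_closure_of_isTightMeasureSet ht).isSeqCompact
    fun n ↦ subset_closure (Set.mem_range_self n)
  refine ⟨σ, inferInstance, fun t ↦ ?_⟩
  exact tendsto_nhds_unique (ProbabilityMeasure.tendsto_iff_tendsto_charFun.1 hlim t)
    ((h t).comp hφ.tendsto_atTop)

lemma measurable_levyIntegrand (ξ : E) : Measurable (levyIntegrand ξ) := by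
  unfold levyIntegrand
  have : Measurable ((Metric.closedBall (0 : E) 1).indicator fun v ↦ (inner ℝ ξ v : ℝ)) :=
    Measurable.indicator (by fun_prop) Metric.isClosed_closedBall.measurableSet
  fun_prop

/-- The compensated compound Poisson law with jump measure `η`. -/
noncomputable def compensatedCompoundPoisson (η : Measure E) : Measure E :=
  (compoundPoisson η).conv (Measure.dirac (-∫ u in Metric.closedBall 0 1, u ∂η))

instance isProbabilityMeasure_compensatedCompoundPoisson (η : Measure E) [IsFiniteMeasure η] :
    IsProbabilityMeasure (compensatedCompoundPoisson η) := by
  unfold compensatedCompoundPoisson; infer_instance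

/-- For finite `η` the three terms of the integrand are separately integrable; the truncated linear
one is exactly the Dirac shift. -/
lemma charFun_compensatedCompoundPoisson (η : Measure E) [IsFiniteMeasure η] (ξ : E) :
    charFun (compensatedCompoundPoisson η) ξ = Complex.exp (∫ u, levyIntegrand ξ u ∂η) := by
  rw [compensatedCompoundPoisson, charFun_conv, charFun_compoundPoisson, charFun_dirac,
    ← Complex.exp_add]
  congr 1
  have hB : MeasurableSet (Metric.closedBall (0 : E) 1) := Metric.isClosed_closedBall.measurableSet
  have hid : Integrable (fun u : E ↦ u) (η.restrict (Metric.closedBall 0 1)) := by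
    refine Integrable.of_bound (by fun_prop) 1 ?_
    filter_upwards [ae_restrict_mem hB] with u hu
    simpa using hu
  have i1 : Integrable (fun x ↦ Complex.exp (⟪x, ξ⟫ * Complex.I)) η :=
    integrable_exp_inner _ ξ
  have i2 : Integrable ((Metric.closedBall (0 : E) 1).indicator fun v ↦ (inner ℝ ξ v : ℝ)) η :=
    (integrable_indicator_iff hB).2 (hid.const_inner ξ)
  have e : levyIntegrand ξ = fun u ↦ Complex.exp (⟪u, ξ⟫ * Complex.I) - 1
      - Complex.I * ((Metric.closedBall (0 : E) 1).indicator (fun v => inner ℝ ξ v) u : ℝ) := by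
    ext u
    rw [levyIntegrand, real_inner_comm, mul_comm Complex.I]
  have i12 : Integrable (fun x ↦ Complex.exp (⟪x, ξ⟫ * Complex.I) - 1) η :=
    i1.sub (integrable_const _)
  have i3 : Integrable (fun x ↦ Complex.I *
      ((Metric.closedBall (0 : E) 1).indicator (fun v ↦ inner ℝ ξ v) x : ℝ)) η :=
    i2.ofReal.const_mul _
  simp only [e]
  rw [integral_sub i12 i3, integral_sub i1 (integrable_const _), ← charFun_apply,
    integral_const_mul, integral_complex_ofReal,
    integral_indicator hB, integral_inner hid ξ]
  simp only [integral_const, Complex.real_smul, mul_one, inner_neg_right, real_inner_comm ξ]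
  push_cast
  ring

end CharFun

/-! ### Splitting off the large jumps. -/

section Decomposition

variable {d : ℕ}

lemma IsLevyMeasure.integrable_min {ν : Measure (EuclideanSpace ℝ (Fin d))}
    (h : IsLevyMeasure ν) : Integrable (fun u ↦ min 1 (‖u‖ ^ 2)) ν := by
  refine ⟨by fun_prop, ?_⟩
  rw [hasFiniteIntegral_iff_ofReal (.of_forall fun u ↦ by positivity)]
  exact h.lintegral_lt_top

lemma IsLevyMeasure.integrable_levyIntegrand {ν : Measure (EuclideanSpace ℝ (Fin d))}
    (h : IsLevyMeasure ν) (ξ : EuclideanSpace ℝ (Fin d)) : Integrable (levyIntegrand ξ) ν :=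
  (h.integrable_min.const_mul _).mono' (measurable_levyIntegrand ξ).aestronglyMeasurable
    (.of_forall fun u ↦ norm_levyIntegrand_le ξ u)

/-- The complement of the ball of radius `1 / (n + 1)` about the origin. -/
def largeJumps (d n : ℕ) : Set (EuclideanSpace ℝ (Fin d)) := {u | 1 / (n + 1 : ℝ) < ‖u‖}

lemma measurableSet_largeJumps (n : ℕ) : MeasurableSet (largeJumps d n) :=
  measurableSet_lt measurable_const measurable_norm

lemma monotone_largeJumps : Monotone (largeJumps d) := fun _ _ h u hu ↦
  (Nat.one_div_le_one_div h).trans_lt (b := _) (c := ‖u‖) hu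

lemma iUnion_largeJumps : ⋃ n, largeJumps d n = {0}ᶜ := by
  ext u
  simp only [largeJumps, Set.mem_iUnion, Set.mem_ofPred_eq, Set.mem_compl_iff,
    Set.mem_singleton_iff]
  refine ⟨?_, fun h ↦ exists_nat_one_div_lt (norm_pos_iff.2 h)⟩
  rintro ⟨n, hn⟩ rfl
  rw [norm_zero] at hn
  exact absurd hn (not_lt.2 (by positivity))

lemma IsLevyMeasure.isFiniteMeasure_restrict_largeJumps {ν : Measure (EuclideanSpace ℝ (Fin d))}
    (h : IsLevyMeasure ν) (n : ℕ) : IsFiniteMeasure (ν.restrict (largeJumps d n)) := by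
  constructor
  rw [Measure.restrict_apply_univ]
  have hr : (0 : ℝ) < (1 / (n + 1 : ℝ)) ^ 2 := by positivity
  refine (measure_mono fun u hu ↦ ?_).trans_lt (h.integrable_min.measure_ge_lt_top hr)
  have hu' : 1 / (n + 1 : ℝ) < ‖u‖ := hu
  have h1 : 1 / (n + 1 : ℝ) ≤ 1 := by
    rw [div_le_one (by positivity)]; linarith [n.cast_nonneg (α := ℝ)]
  have h0 : 0 < 1 / (n + 1 : ℝ) := by positivity
  change (1 / (n + 1 : ℝ)) ^ 2 ≤ min 1 (‖u‖ ^ 2)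
  exact le_min (pow_le_one₀ h0.le h1) (by gcongr)

lemma levyKhintchineExponent_eq (b : EuclideanSpace ℝ (Fin d)) (A : Matrix (Fin d) (Fin d) ℝ)
    (ν : Measure (EuclideanSpace ℝ (Fin d))) (ξ : EuclideanSpace ℝ (Fin d)) :
    levyKhintchineExponent b A ν ξ = Complex.I * (inner ℝ b ξ : ℝ)
      - (1 / 2 : ℂ) * (inner ℝ ξ (A.toEuclideanLin ξ) : ℝ) + ∫ u, levyIntegrand ξ u ∂ν := rfl

/-- An infinitely divisible law splits off the compensated compound Poisson law of its large
jumps. -/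
theorem IsInfinitelyDivisibleWithTriplet.exists_eq_conv {μ : Measure (EuclideanSpace ℝ (Fin d))}
    {b : EuclideanSpace ℝ (Fin d)} {A : Matrix (Fin d) (Fin d) ℝ}
    {ν : Measure (EuclideanSpace ℝ (Fin d))} (h : IsInfinitelyDivisibleWithTriplet μ b A ν)
    (n : ℕ) :
    ∃ σ : Measure (EuclideanSpace ℝ (Fin d)), IsProbabilityMeasure σ ∧
      μ = (compensatedCompoundPoisson (ν.restrict (largeJumps d n))).conv σ := by
  have := h.isProbabilityMeasure
  have hfin := h.isLevyMeasure.isFiniteMeasure_restrict_largeJumps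
  set κ := compensatedCompoundPoisson (ν.restrict (largeJumps d n)) with hκ
  have hκ0 (ξ) : charFun κ ξ ≠ 0 := by
    rw [hκ, charFun_compensatedCompoundPoisson]; exact Complex.exp_ne_zero _
  -- The Gaussian part together with the compensated jumps of length in `(1 / (m + 1), 1 / (n +
  -- 1)]`: a finite jump measure for each `m`.
  let τ : ℕ → Measure (EuclideanSpace ℝ (Fin d)) := fun m ↦
    (ProbabilityTheory.multivariateGaussian b A).conv
      (compensatedCompoundPoisson ((ν.restrict (largeJumps d m)).restrict (largeJumps d n)ᶜ))
  have hτ (m) : IsProbabilityMeasure (τ m) := by dsimp only [τ]; infer_instance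
  have hlim (ξ) : Tendsto (fun m ↦ charFun (τ m) ξ) atTop (𝓝 (charFun μ ξ / charFun κ ξ)) := by
    have hi := h.isLevyMeasure.integrable_levyIntegrand ξ
    have e1 (m) : charFun (τ m) ξ = Complex.exp (Complex.I * (inner ℝ b ξ : ℝ)
        - (1 / 2 : ℂ) * (inner ℝ ξ (A.toEuclideanLin ξ) : ℝ)
        + ∫ u in largeJumps d m, levyIntegrand ξ u ∂ν.restrict (largeJumps d n)ᶜ) := by
      rw [charFun_conv, charFun_compensatedCompoundPoisson,
        ProbabilityTheory.charFun_multivariateGaussian h.posSemidef, ← Complex.exp_add,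
        Measure.restrict_restrict (measurableSet_largeJumps n).compl,
        Measure.restrict_restrict (measurableSet_largeJumps m), Set.inter_comm]
      congr 2
      have hA : (inner ℝ ξ (A.toEuclideanLin ξ) : ℝ) = ξ.ofLp ⬝ᵥ A *ᵥ ξ.ofLp := by
        rw [EuclideanSpace.inner_eq_star_dotProduct, Matrix.toLpLin_apply,
          star_trivial, dotProduct_comm]
      rw [hA, real_inner_comm]
      ring
    have e2 : charFun μ ξ / charFun κ ξ = Complex.exp (Complex.I * (inner ℝ b ξ : ℝ)
        - (1 / 2 : ℂ) * (inner ℝ ξ (A.toEuclideanLin ξ) : ℝ)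
        + ∫ u in ⋃ m, largeJumps d m, levyIntegrand ξ u ∂ν.restrict (largeJumps d n)ᶜ) := by
      -- The union misses only the origin, which is `ν`-null.
      have e3 : (ν.restrict (largeJumps d n)ᶜ).restrict (⋃ m, largeJumps d m)
          = ν.restrict (largeJumps d n)ᶜ := by
        rw [iUnion_largeJumps]
        refine Measure.restrict_eq_self_of_ae_mem ?_
        refine ae_restrict_of_ae ?_
        have := h.isLevyMeasure.zero_singleton
        rw [ae_iff]
        simpa using this
      rw [h.charFun_eq, hκ, charFun_compensatedCompoundPoisson, ← Complex.exp_sub, e3,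
        levyKhintchineExponent_eq,
        ← integral_add_compl (measurableSet_largeJumps n) hi]
      congr 1
      ring
    simp_rw [e1, e2]
    refine (Complex.continuous_exp.tendsto _).comp (tendsto_const_nhds.add ?_)
    exact tendsto_setIntegral_of_monotone measurableSet_largeJumps monotone_largeJumps
      hi.restrict.integrableOn
  have hcont : ContinuousAt (fun ξ ↦ charFun μ ξ / charFun κ ξ) 0 :=
    (continuous_charFun.div continuous_charFun hκ0).continuousAt
  obtain ⟨σ, hσ, hσ'⟩ := exists_charFun_eq_of_tendsto hcont hlim
  refine ⟨σ, hσ, Measure.ext_of_charFun ?_⟩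
  ext ξ
  rw [charFun_conv, hσ', mul_div_cancel₀ _ (hκ0 ξ)]

/-- An infinitely divisible law dominates its convolution with its Lévy measure. -/
theorem IsInfinitelyDivisibleWithTriplet.conv_absolutelyContinuous
    {μ : Measure (EuclideanSpace ℝ (Fin d))}
    {b : EuclideanSpace ℝ (Fin d)} {A : Matrix (Fin d) (Fin d) ℝ}
    {ν : Measure (EuclideanSpace ℝ (Fin d))} (h : IsInfinitelyDivisibleWithTriplet μ b A ν) :
    ν.conv μ ≪ μ := by
  have := h.isProbabilityMeasure
  refine conv_absolutelyContinuous_of_iUnion ν μ μ (largeJumps d)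
    (by rw [iUnion_largeJumps, compl_compl]; exact h.isLevyMeasure.zero_singleton) fun n ↦ ?_
  have hfin := h.isLevyMeasure.isFiniteMeasure_restrict_largeJumps n
  obtain ⟨σ, hσ, hμ⟩ := h.exists_eq_conv n
  -- Regroup so that the restricted `ν` meets the compound Poisson factor, with the shift and `σ` as
  -- a common right factor.
  rw [hμ, compensatedCompoundPoisson, Measure.conv_assoc, ← Measure.conv_assoc]
  exact AbsolutelyContinuous.conv (conv_compoundPoisson_absolutelyContinuous _)
    Measure.AbsolutelyContinuous.rfl

end Decomposition

theorem mainTheorem11 {d : ℕ} {Ω Ω' : Type*} [MeasurableSpace Ω] [MeasurableSpace Ω']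
    (P : Measure Ω) [IsProbabilityMeasure P] (P' : Measure Ω') [IsProbabilityMeasure P']
    (X : Ω → EuclideanSpace ℝ (Fin d)) (Y : Ω' → EuclideanSpace ℝ (Fin d))
    (hX : AEMeasurable X P) (hY : AEMeasurable Y P')
    (ν : Measure (EuclideanSpace ℝ (Fin d)))
    (hXnd : IsNonDegenerate (P.map X))
    (hXid : IsInfinitelyDivisibleWithLevyMeasure (P.map X) ν)
    (hYnd : IsNonDegenerate (P'.map Y))
    (hYX : P'.map Y ≪ P.map X) (hXY : P.map X ≪ P'.map Y) :
    P'.map Y ∈ levyAbsContClass ν := by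
  obtain ⟨b, A, h⟩ := hXid
  exact ⟨Measure.isProbabilityMeasure_map hY,
    (AbsolutelyContinuous.conv Measure.AbsolutelyContinuous.rfl hYX).trans
      (h.conv_absolutelyContinuous.trans hXY)⟩
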